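/- Let $k,q\ge 1$ be integers. Let $W_{k,q}=\{\mathbf v\in\mathbb Z^{k-1}: 0\le v_1\le\dots\le v_{k-1}\le q\}$. For $\mathbf v\in W_{k,q}$ with $\mathbf v+(1,\dots,1)\in W_{k,q}$ and a permutation $\pi=\pi_1\cdots\pi_{k-1}$ of $\{1,\dots,k-1\}$ in which $i$ appears before $i+1$ whenever $v_i=v_{i+1}$, let $F(\mathbf v,\pi)=\{\mathbf v^{(1)},\dots,\mathbf v^{(k)}\}$, where $\mathbf v^{(1)}=\mathbf v$ and $\mathbf v^{(i+1)}=\mathbf v^{(i)}+e_{\pi_{k-i}}$ for $1\le i\le k-1$. The edgewise subdivision $T_{k,q}$ is the simplicial complex whose facets are the sets $F(\mathbf v,\pi)$. For $\mathbf a=(a_1,\dots,a_{k-1})\in\mathcal S_{k,q}=\{0,\dots,q-1\}^{k-1}$ let $\alpha$ be the permutation with $a_{\alpha_1}\le\dots\le a_{\alpha_{k-1}}$, where $\alpha_i<\alpha_{i+1}$ whenever $a_{\alpha_i}=a_{\alpha_{i+1}}$; put $\mathbf v_a=(a_{\alpha_1},\dots,a_{\alpha_{k-1}})$ and $F(\mathbf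 a)=F(\mathbf v_a,\alpha^{-1})=\{\mathbf v_a^{(1)},\dots,\mathbf v_a^{(k)}\}$. Put $a_0=0$, $m(\mathbf a)=\max_{1\le i\le k-1} a_i$ (and $m(\mathbf a)=0$ if $k=1$), $S(\mathbf a)=\sum_{i=1}^{k-1} a_i$, and let $F(\mathbf a)<F(\mathbf b)$ mean that $m(\mathbf a)<m(\mathbf b)$, or $m(\mathbf a)=m(\mathbf b)$ and $S(\mathbf a)<S(\mathbf b)$, or $m(\mathbf a)=m(\mathbf b)$, $S(\mathbf a)=S(\mathbf b)$ and there is an $i$ with $a_i>b_i$ and $a_j=b_j$ for all $j<i$. A linear order on the facets of a pure finite simplicial complex is a shelling order if for all facets $F<G$ there are a facet $H<G$ and a vertex $v\in G$ with $F\cap G\subseteq H\cap G=G\setminus\{v\}$; the restriction $\mathcal R(G)$ is the set of those vertices $v$ of $G$ for which $G\setminus\{v\}\subseteq F$ for some facet $F<G$. The $h$-vector of a $d$-dimensional complex with $f_{i}$ faces of dimension $i$ ($f_{-1}=1$) is $(h_0,\dots,h_{d+1})$ with $h_s=\sum_{i=0}^{s}(-1)^{s-i}\binom{d+1-i}{d+1-s}f_{i-1}$.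 Then: (1) $T_{k,q}$ is pure, $\mathbf a\mapsto F(\mathbf a)$ is a bijection from $\mathcal S_{k,q}$ onto the set of facets of $T_{k,q}$, and $<$ is a shelling order for $T_{k,q}$. (2) For every $\mathbf a\in\mathcal S_{k,q}$, the restriction of $F(\mathbf a)$ in this shelling order is $\mathcal R(F(\mathbf a))=\{\mathbf v_a^{(k+1-i)}: 1\le i\le k-1,\ a_{i-1}<a_i\}$. (3) For every $0\le i\le k$, $$h_i(T_{k,q})=\Big|\big\{(0,a_1,\dots,a_{k-1})\in\{0\}\times\mathcal S_{k,q}:\ |\{j\in\{1,\dots,k-1\}: a_{j-1}<a_j\}|=i\big\}\Big|.$$ -/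

import Mathlib

namespace Edgewise

/-! ### Simplicial complexes: facets, `h`-vector, shellings

Mathlib's `PreAbstractSimplicialComplex` lists the nonempty faces; the empty face is
accounted for separately (it is `f_{-1} = 1`). -/

section Complexes

variable {V : Type*}

/-- A facet is an inclusion-maximal face. -/
def IsFacet (K : PreAbstractSimplicialComplex V) (s : Finset V) : Prop :=
  Maximal (fun t => t ∈ K.faces) s

/-- All facets have the same number of vertices. -/
def IsPure (K : PreAbstractSimplicialComplex V) : Prop :=
  ∀ s t, IsFacet K s → IsFacet K t → s.card = t.card

/-- `dim K + 1`: the largest number of vertices of a face (for a finite complex). -/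
noncomputable def dimSucc (K : PreAbstractSimplicialComplex V) : ℕ :=
  sSup {n | ∃ s ∈ K.faces, s.card = n}

/-- `f_{i-1}(K)`: the number of faces with exactly `i` vertices; `f_{-1} = 1` counts the
empty face. -/
noncomputable def faceCount (K : PreAbstractSimplicialComplex V) (i : ℕ) : ℕ :=
  if i = 0 then 1 else {s | s ∈ K.faces ∧ s.card = i}.ncard

/-- With `d = dim K` and `0 ≤ s ≤ d + 1`,
`h_s(K) = ∑_{i=0}^{s} (-1)^{s-i} * C(d+1-i, d+1-s) * f_{i-1}(K)`. -/
noncomputable def hVector (K : PreAbstractSimplicialComplex V) (s : ℕ) : ℤ :=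
  ∑ i ∈ Finset.range (s + 1),
    (-1) ^ (s - i) * ((dimSucc K - i).choose (dimSucc K - s) : ℤ) * (faceCount K i : ℤ)

variable [DecidableEq V] {ι : Type*}

/-- The family `F : ι → Finset V`, listed according to the relation `r` on the finite index
set `ι`, is a shelling order of `K`: `K` is pure, `F` enumerates each facet of `K` exactly
once, `r` is a strict linear order, and whenever `F i` comes before `F j` there are `F l`
before `F j` and a vertex `v` of `F j` with `F i ∩ F j ⊆ F l ∩ F j = F j \ {v}`. -/
structure IsShellingOrder (K : PreAbstractSimplicialComplex V) (F : ι → Finset V)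
    (r : ι → ι → Prop) : Prop where
  pure : IsPure K
  finite : Finite ι
  bijOn : Set.BijOn F Set.univ {s | IsFacet K s}
  irrefl : ∀ i, ¬ r i i
  trans : ∀ i j l, r i j → r j l → r i l
  total : ∀ i j, r i j ∨ i = j ∨ r j i
  shell : ∀ i j, r i j → ∃ l, r l j ∧ ∃ v ∈ F j,
    F i ∩ F j ⊆ F l ∩ F j ∧ F l ∩ F j = F j \ {v}

/-- The restriction of the facet `F j` with respect to the order `r`: the vertices `v` of
`F j` such that `F j \ {v}` is contained in an earlier facet. -/
def restriction (F : ι → Finset V) (r : ι → ι → Prop) (j : ι) : Set V :=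
  {v | v ∈ F j ∧ ∃ i, r i j ∧ F j \ {v} ⊆ F i}

end Complexes

/-! ### The edgewise subdivision `T_{k,q}`

Coordinates are indexed by `Fin (k - 1)`: the coordinate `x_i` is `x ⟨i - 1, _⟩`, and the
entry `π_i` of a permutation is `π ⟨i - 1, _⟩`, counted from zero. -/

/-- The lattice points `0 ≤ v_1 ≤ ⋯ ≤ v_{k-1} ≤ q`. -/
def W (k q : ℕ) : Set (Fin (k - 1) → ℤ) :=
  {v | Monotone v ∧ ∀ i, 0 ≤ v i ∧ v i ≤ q}

/-- `π` is consistent with `v`: `i` is before `i + 1` in the word `π` whenever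
`v_i = v_{i+1}`. -/
def Consistent {k : ℕ} (v : Fin (k - 1) → ℤ) (π : Equiv.Perm (Fin (k - 1))) : Prop :=
  ∀ i j : Fin (k - 1), (i : ℕ) + 1 = j → v i = v j → π.symm i < π.symm j

/-- `v^{(i)} = v + e_{π_{k-1}} + e_{π_{k-2}} + ⋯ + e_{π_{k+1-i}}`, for `1 ≤ i ≤ k`. The summand
`e_{π_m}` occurs if and only if `k + 1 - i ≤ m`, and `m = j + 1` for the index `j` below. -/
def vert {k : ℕ} (v : Fin (k - 1) → ℤ) (π : Equiv.Perm (Fin (k - 1))) (i : ℕ) :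
    Fin (k - 1) → ℤ :=
  v + ∑ j ∈ Finset.univ.filter (fun j : Fin (k - 1) => k ≤ (j : ℕ) + i), Pi.single (π j) 1

/-- The vertex set `{v^{(1)}, …, v^{(k)}}` of `F(v, π)`. -/
def cell {k : ℕ} (v : Fin (k - 1) → ℤ) (π : Equiv.Perm (Fin (k - 1))) :
    Finset (Fin (k - 1) → ℤ) :=
  (Finset.Icc 1 k).image (vert v π)

/-- The edgewise subdivision `T_{k,q}`: its faces are the nonempty subsets of the cells
`F(v, π)`, where `v` and `v + (1, …, 1)` are in `W_{k,q}` and `π` is consistent with `v`. -/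
def T (k q : ℕ) : PreAbstractSimplicialComplex (Fin (k - 1) → ℤ) where
  faces := {s | s.Nonempty ∧ ∃ v π, v ∈ W k q ∧ v + 1 ∈ W k q ∧ Consistent v π ∧ s ⊆ cell v π}
  isRelLowerSet_faces := by
    rintro s ⟨hs, v, π, h₁, h₂, h₃, h₄⟩
    exact ⟨hs, fun t hts ht => ⟨ht, v, π, h₁, h₂, h₃, hts.trans h₄⟩⟩

/-! ### Facets as sequences `a ∈ {0, …, q-1}^{k-1}` -/

/-- The sequences `(a_1, …, a_{k-1})` with entries in `{0, …, q-1}`. -/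
abbrev Seq (k q : ℕ) : Type := Fin (k - 1) → Fin q

/-- The permutation `α` with `a_{α_1} ≤ ⋯ ≤ a_{α_{k-1}}`, ties being ordered by increasing
index (`Tuple.sort` is the stable sort). -/
def sortPerm {k q : ℕ} (a : Seq k q) : Equiv.Perm (Fin (k - 1)) := Tuple.sort a

/-- `v_a^{(i)}`, the `i`-th vertex (`1 ≤ i ≤ k`) of `F(a) = F(v_a, α⁻¹)`, where
`v_a = (a_{α_1}, …, a_{α_{k-1}})`. -/
def seqVert {k q : ℕ} (a : Seq k q) (i : ℕ) : Fin (k - 1) → ℤ :=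
  vert (fun j => ((a (sortPerm a j) : ℕ) : ℤ)) (sortPerm a)⁻¹ i

/-- The vertex set `{v_a^{(1)}, …, v_a^{(k)}}` of `F(a)`. -/
def seqFacet {k q : ℕ} (a : Seq k q) : Finset (Fin (k - 1) → ℤ) :=
  (Finset.Icc 1 k).image (seqVert a)

/-- The maximal entry `m(a)` (zero for the empty sequence). -/
def maxEntry {k q : ℕ} (a : Seq k q) : ℕ := Finset.univ.sup fun j => (a j : ℕ)

/-- The sum `S(a)` of the entries. -/
def sumEntries {k q : ℕ} (a : Seq k q) : ℕ := ∑ j, (a j : ℕ)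

/-- `F(a)` comes before `F(b)`: compare `m`, then `S`, then the entries in reversed
lexicographic order (the larger entry at the first difference comes first). -/
def Precedes {k q : ℕ} (a b : Seq k q) : Prop :=
  maxEntry a < maxEntry b ∨
  (maxEntry a = maxEntry b ∧ sumEntries a < sumEntries b) ∨
  (maxEntry a = maxEntry b ∧ sumEntries a = sumEntries b ∧
    ∃ i, b i < a i ∧ ∀ j, j < i → a j = b j)

/-- The sequence `(a_0, a_1, …, a_{k-1})` with `a_0 = 0`. -/
def zeroCons {k q : ℕ} (a : Seq k q) : Fin (k - 1 + 1) → ℕ :=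
  Fin.cons 0 fun j => (a j : ℕ)

/-- The ascents `{i ∈ [k-1] : a_{i-1} < a_i}` of `(0, a_1, …, a_{k-1})`; the ascent `i` is
represented by `j = i - 1` in `Fin (k - 1)`. -/
def ascents {k q : ℕ} (a : Seq k q) : Finset (Fin (k - 1)) :=
  Finset.univ.filter fun j => zeroCons a j.castSucc < zeroCons a j.succ

end Edgewise

/-! The vertices of `F(b)` are the sorted rearrangements of the words obtained from `b` by
increasing the letters of a final segment by one, so incidences between facets become statements
about counting letters in words.

Let `R(b)` be the set of the vertices of `F(b)` that belong to the ascents of `b`. Each vertex in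
`R(b)` can be exchanged within an earlier facet: swap the two letters at the ascent or, for an
ascent at the start, move the first letter to the end and lower it by one. Conversely, let `F(a)`
contain `R(b)`. The first maximal letter of `b`, if positive, is an ascent, whence `m(b) ≤ m(a)`;
counting the positive letters at the first ascent gives `S(b) ≤ S(a)`; and if the sums agree, then
counting large letters before the next ascent shows that, where `a` and `b` first differ, `b` has
the larger letter. So `F(a)` does not precede `F(b)`.

These two properties of `R` say that `<` is a shelling order with restriction `R`. The intervals
`[R(b), F(b)]` then partition the faces, and the alternating sum that defines `h_s` is `1` on an
interval with `|R(b)| = s` and `0` on every other interval. -/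

namespace Edgewise

open Finset

section Shelling

variable {V ι : Type*} {K : PreAbstractSimplicialComplex V} {F R : ι → Finset V}
  {r : ι → ι → Prop} {d : ℕ}

/-- The faces of `K` are the nonempty subsets of the members of the family `F`, which describes
a complex by a list of candidates for its facets. -/
def IsGeneratedBy (K : PreAbstractSimplicialComplex V) (F : ι → Finset V) : Prop :=
  ∀ s, s ∈ K.faces ↔ s.Nonempty ∧ ∃ i, s ⊆ F i

theorem IsGeneratedBy.isFacet_iff (hK : IsGeneratedBy K F) (hF : ∀ i, #(F i) = d) (hd : 0 < d)
    {s : Finset V} : IsFacet K s ↔ s ∈ Set.range F := by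
  have hface (i : ι) : F i ∈ K.faces :=
    (hK _).2 ⟨card_pos.1 (hF i ▸ hd), i, Subset.rfl⟩
  constructor
  · rintro ⟨hs, hmax⟩
    obtain ⟨-, i, hi⟩ := (hK s).1 hs
    exact ⟨i, (hmax (hface i) hi).antisymm hi⟩
  · rintro ⟨i, rfl⟩
    refine ⟨hface i, fun t ht hit => ?_⟩
    obtain ⟨-, j, hj⟩ := (hK t).1 ht
    have hij : F i = F j := eq_of_subset_of_card_le (Subset.trans hit hj) (by rw [hF, hF])
    exact hij ▸ hj

theorem IsGeneratedBy.isPure (hK : IsGeneratedBy K F) (hF : ∀ i, #(F i) = d) (hd : 0 < d) :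
    IsPure K := by
  intro s t hs ht
  obtain ⟨i, rfl⟩ := (hK.isFacet_iff hF hd).1 hs
  obtain ⟨j, rfl⟩ := (hK.isFacet_iff hF hd).1 ht
  rw [hF, hF]

theorem IsGeneratedBy.faceCount_eq_card [DecidableEq V] [Fintype ι] [Nonempty ι]
    (hK : IsGeneratedBy K F) (c : ℕ) :
    faceCount K c = #{s ∈ univ.biUnion fun i => (F i).powerset | #s = c} := by
  rw [faceCount]
  split_ifs with hc
  · have hempty : {s ∈ univ.biUnion fun i => (F i).powerset | #s = c} = {∅} := by
      ext s
      simp only [hc, card_eq_zero, mem_filter, mem_biUnion, mem_univ, true_and, mem_powerset,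
        mem_singleton, and_iff_right_iff_imp]
      rintro rfl
      exact ⟨Classical.arbitrary ι, empty_subset _⟩
    rw [hempty, card_singleton]
  · rw [← Set.ncard_coe_finset]
    congr 1
    ext s
    simp only [hK s, Set.mem_ofPred_eq, coe_filter, mem_biUnion, mem_univ, true_and, mem_powerset]
    exact and_congr_left fun hs => and_iff_right (card_pos.1 (by omega))

variable [DecidableEq V]

/-- A certificate that `r` is a shelling order whose restriction sets are the `R j`: no facet
before `F j` contains `R j`, but removing any vertex of `R j` from `F j` leaves a subset of an
earlier facet. -/
structure IsRestrictionMap (F : ι → Finset V) (r : ι → ι → Prop) (R : ι → Finset V) : Prop where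
  subset : ∀ j, R j ⊆ F j
  not_subset_of_rel : ∀ i j, r i j → ¬ R j ⊆ F i
  exists_sdiff_subset : ∀ j, ∀ v ∈ R j, ∃ i, r i j ∧ F j \ {v} ⊆ F i

theorem IsRestrictionMap.mem_and_notMem (hR : IsRestrictionMap F r R) {i j : ι} (hij : r i j)
    {v : V} (hv : F j \ {v} ⊆ F i) : v ∈ R j ∧ v ∉ F i := by
  obtain ⟨w, hwR, hwF⟩ := not_subset.1 (hR.not_subset_of_rel i j hij)
  obtain rfl : w = v := by
    by_contra hne
    exact hwF (hv (mem_sdiff.2 ⟨hR.subset j hwR, notMem_singleton.2 hne⟩))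
  exact ⟨hwR, hwF⟩

theorem IsRestrictionMap.restriction_eq (hR : IsRestrictionMap F r R) (j : ι) :
    restriction F r j = R j :=
  Set.ext fun v => ⟨fun ⟨_, _, hij, hv⟩ => (hR.mem_and_notMem hij hv).1,
    fun hv => ⟨hR.subset j hv, hR.exists_sdiff_subset j v hv⟩⟩

theorem IsRestrictionMap.injective [Std.Trichotomous r] (hR : IsRestrictionMap F r R) :
    Function.Injective F := by
  have not_rel {i j : ι} (hFij : F i = F j) : ¬ r i j := fun hij =>
    hR.not_subset_of_rel i j hij (hFij ▸ hR.subset j)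
  exact fun i j hFij => Std.Trichotomous.trichotomous i j (not_rel hFij) (not_rel hFij.symm)

theorem IsRestrictionMap.exists_inter_eq (hR : IsRestrictionMap F r R) {i j : ι} (hij : r i j) :
    ∃ l, r l j ∧ ∃ v ∈ F j, F i ∩ F j ⊆ F l ∩ F j ∧ F l ∩ F j = F j \ {v} := by
  obtain ⟨v, hvR, hvi⟩ := not_subset.1 (hR.not_subset_of_rel i j hij)
  obtain ⟨l, hlj, hsub⟩ := hR.exists_sdiff_subset j v hvR
  have hvl : v ∉ F l := (hR.mem_and_notMem hlj hsub).2
  have hinter : F l ∩ F j = F j \ {v} := by grind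
  exact ⟨l, hlj, v, hR.subset j hvR, by grind, hinter⟩

theorem IsRestrictionMap.isShellingOrder [Finite ι] [IsStrictTotalOrder ι r]
    (hR : IsRestrictionMap F r R) (hK : IsGeneratedBy K F) (hF : ∀ i, #(F i) = d) (hd : 0 < d) :
    IsShellingOrder K F r where
  pure := hK.isPure hF hd
  finite := inferInstance
  bijOn := by
    refine ⟨fun i _ => (hK.isFacet_iff hF hd).2 ⟨i, rfl⟩, hR.injective.injOn, fun s hs => ?_⟩
    rw [Set.image_univ]
    exact (hK.isFacet_iff hF hd).1 hs
  irrefl := irrefl_of r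
  trans _ _ _ := trans_of r
  total := trichotomous_of r
  shell _ _ := hR.exists_inter_eq

namespace IsShellingOrder

theorem not_restriction_subset (h : IsShellingOrder K F r) {i j : ι} (hij : r i j) :
    ¬ restriction F r j ⊆ F i := by
  obtain ⟨l, hlj, v, hv, hsub, heq⟩ := h.shell i j hij
  have hvi : v ∉ F i := fun hvi => by
    have : v ∈ F j \ {v} := heq ▸ hsub (mem_inter.2 ⟨hvi, hv⟩)
    exact notMem_sdiff_of_mem_right (mem_singleton_self v) this
  exact fun hR => hvi (hR ⟨hv, l, hlj, heq ▸ inter_subset_left⟩)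

theorem existsUnique_restriction_subset (h : IsShellingOrder K F r) {s : Finset V}
    (hs : ∃ i, s ⊆ F i) : ∃! i, restriction F r i ⊆ s ∧ s ⊆ F i := by
  have := h.finite
  have : Std.Irrefl r := ⟨h.irrefl⟩
  have : IsTrans ι r := ⟨h.trans⟩
  have not_rel {i j : ι} (hj : restriction F r j ⊆ s) (hi : s ⊆ F i) : ¬ r i j := fun hij =>
    h.not_restriction_subset hij (hj.trans (coe_subset.2 hi))
  obtain ⟨i, hi, hmin⟩ := (Finite.wellFounded_of_trans_of_irrefl r).has_min {i | s ⊆ F i} hs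
  have hRi : restriction F r i ⊆ s := by
    rintro v ⟨-, l, hli, hsub⟩
    by_contra hvs
    exact hmin l (fun x hx => hsub (by grind)) hli
  refine ⟨i, ⟨hRi, hi⟩, fun j ⟨hRj, hj⟩ => ?_⟩
  rcases h.total i j with hij | rfl | hji
  · exact absurd hij (not_rel hRj hi)
  · rfl
  · exact absurd hji (not_rel hRi hj)

theorem dimSucc_eq (h : IsShellingOrder K F r) (hK : IsGeneratedBy K F) (i : ι) :
    dimSucc K = #(F i) := by
  have hfacet (j : ι) : IsFacet K (F j) := h.bijOn.mapsTo (Set.mem_univ j)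
  refine IsGreatest.csSup_eq ⟨⟨F i, (hfacet i).prop, rfl⟩, ?_⟩
  rintro _ ⟨s, hs, rfl⟩
  obtain ⟨-, j, hj⟩ := (hK s).1 hs
  exact (card_le_card hj).trans (h.pure _ _ (hfacet j) (hfacet i)).le

theorem faceCount_eq_sum [Fintype ι] [Nonempty ι] (h : IsShellingOrder K F r)
    (hK : IsGeneratedBy K F) (hR : ∀ i, restriction F r i = R i) (c : ℕ) :
    faceCount K c = ∑ i, #{s ∈ Icc (R i) (F i) | #s = c} := by
  have hunique {s : Finset V} (hs : ∃ i, s ⊆ F i) : ∃! i, s ∈ Icc (R i) (F i) := by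
    simpa only [hR, coe_subset, mem_Icc] using h.existsUnique_restriction_subset hs
  have hcover : univ.biUnion (fun i => (F i).powerset) =
      univ.biUnion fun i => Icc (R i) (F i) := by
    ext s
    simp only [mem_biUnion, mem_univ, true_and, mem_powerset]
    exact ⟨fun hs => (hunique hs).exists, fun ⟨i, hi⟩ => ⟨i, (mem_Icc.1 hi).2⟩⟩
  rw [hK.faceCount_eq_card, hcover, filter_biUnion, card_biUnion]
  intro i _ j _ hij
  refine disjoint_left.2 fun s hsi hsj => hij ?_
  have hsi := (mem_filter.1 hsi).1
  exact (hunique ⟨i, (mem_Icc.1 hsi).2⟩).unique hsi (mem_filter.1 hsj).1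

end IsShellingOrder

theorem card_filter_Icc_card_eq {A B : Finset V} (hAB : A ⊆ B) (c : ℕ) :
    #{s ∈ Icc A B | #s = c} = if #A ≤ c then (#B - #A).choose (c - #A) else 0 := by
  have hdisj {s : Finset V} (hs : s ∈ (B \ A).powerset) : Disjoint A s :=
    disjoint_sdiff.mono_right (mem_powerset.1 hs)
  have hinj : Set.InjOn (A ∪ ·) ((B \ A).powerset : Set (Finset V)) := fun s hs t ht hst => by
    rw [← union_sdiff_cancel_left (hdisj hs), ← union_sdiff_cancel_left (hdisj ht)]
    exact congrArg (· \ A) hst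
  rw [Icc_eq_image_powerset hAB, filter_image,
    card_image_of_injOn (hinj.mono (coe_subset.2 (filter_subset _ _)))]
  have hcard : {s ∈ (B \ A).powerset | #(A ∪ s) = c} = {s ∈ (B \ A).powerset | #A + #s = c} :=
    filter_congr fun s hs => by rw [card_union_of_disjoint (hdisj hs)]
  rw [hcard, ← card_sdiff_of_subset hAB]
  split_ifs with hc
  · rw [← card_powersetCard, powersetCard_eq_filter]
    exact congrArg card (filter_congr fun s _ => by omega)
  · exact card_eq_zero.2 (filter_eq_empty_iff.2 fun s _ => by omega)

theorem sum_neg_one_pow_mul_choose_mul_choose {n m : ℕ} (hmn : m ≤ n) :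
    ∑ i ∈ range (m + 1), (-1 : ℤ) ^ (m - i) * (n - i).choose (n - m) * n.choose i =
      if m = 0 then 1 else 0 := by
  have hterm : ∀ i ∈ range (m + 1), (-1 : ℤ) ^ (m - i) * (n - i).choose (n - m) * n.choose i =
      (-1) ^ m * n.choose m * ((-1) ^ i * m.choose i) := by
    intro i hi
    have him : i ≤ m := Nat.lt_succ_iff.1 (mem_range.1 hi)
    have hsymm : (n - i).choose (n - m) = (n - i).choose (m - i) :=
      Nat.choose_symm_of_eq_add (by omega)
    have hmul : (n.choose m : ℤ) * m.choose i = n.choose i * (n - i).choose (m - i) :=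
      mod_cast Nat.choose_mul him
    have hsign : (-1 : ℤ) ^ (m - i) = (-1) ^ m * (-1) ^ i := by
      rw [← pow_add, show m + i = m - i + 2 * i by omega, pow_add, pow_mul, neg_one_sq, one_pow,
        mul_one]
    rw [hsymm, hsign]
    linear_combination -((-1) ^ m * (-1) ^ i) * hmul
  rw [sum_congr rfl hterm, ← mul_sum, Int.alternating_sum_range_choose]
  split_ifs with hm
  · simp [hm]
  · rw [mul_zero]

theorem sum_neg_one_pow_mul_card_filter_Icc {A B : Finset V} (hAB : A ⊆ B) {s : ℕ}
    (hs : s ≤ #B) :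
    ∑ c ∈ range (s + 1), (-1 : ℤ) ^ (s - c) * (#B - c).choose (#B - s) *
      #{t ∈ Icc A B | #t = c} = if #A = s then 1 else 0 := by
  have hAB' := card_le_card hAB
  simp only [card_filter_Icc_card_eq hAB]
  rcases lt_or_ge s #A with hsA | hAs
  · rw [if_neg hsA.ne']
    refine sum_eq_zero fun c hc => ?_
    rw [if_neg (by grind), Nat.cast_zero, mul_zero]
  · have hshift := sum_neg_one_pow_mul_choose_mul_choose (n := #B - #A) (m := s - #A) (by omega)
    rw [← sum_range_add_sum_Ico _ (by omega : #A ≤ s + 1), sum_eq_zero fun c hc => ?_, zero_add,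
      sum_Ico_eq_sum_range, show s + 1 - #A = s - #A + 1 by omega]
    · simp only [le_add_iff_nonneg_right, zero_le, if_true, add_tsub_cancel_left, Nat.sub_add_eq]
      rw [Nat.sub_sub_sub_cancel_right hAs] at hshift
      rw [hshift]
      exact if_congr (by omega) rfl rfl
    · rw [if_neg (by simpa using hc), Nat.cast_zero, mul_zero]

theorem IsShellingOrder.hVector_eq_card [Fintype ι] [Nonempty ι] (h : IsShellingOrder K F r)
    (hK : IsGeneratedBy K F) (hR : ∀ i, restriction F r i = R i) {s : ℕ} (hs : s ≤ dimSucc K) :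
    hVector K s = #{i | #(R i) = s} := by
  have hsum (i : ι) := sum_neg_one_pow_mul_card_filter_Icc (A := R i) (B := F i)
    (coe_subset.1 (hR i ▸ fun v hv => hv.1)) (h.dimSucc_eq hK i ▸ hs)
  simp only [← h.dimSucc_eq hK] at hsum
  simp only [hVector, h.faceCount_eq_sum hK hR, Nat.cast_sum, mul_sum]
  rw [sum_comm, sum_congr rfl fun i _ => hsum i, sum_boole]

end Shelling

section Words

variable {n : ℕ} {x y : Fin n → ℕ} {s t : ℕ}

/-- The word `x` with the letters of its final segment `x_t, x_{t+1}, …` (counted from zero)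
increased by one. The vertices of the facet of `a` are the sorted words `raise a t`. -/
def raise (x : Fin n → ℕ) (t : ℕ) : Fin n → ℕ := fun j => x j + if t ≤ j then 1 else 0

theorem raise_of_le {j : Fin n} (h : t ≤ j) : raise x t j = x j + 1 := by
  rw [raise, if_pos h]

theorem raise_of_lt {j : Fin n} (h : j < t) : raise x t j = x j := by
  rw [raise, if_neg h.not_ge, add_zero]

theorem raise_le (x : Fin n → ℕ) (t : ℕ) (j : Fin n) : raise x t j ≤ x j + 1 := by
  rw [raise]
  split_ifs <;> omega

theorem monotone_raise_comp_sort (x : Fin n → ℕ) (t : ℕ) :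
    Monotone (raise x t ∘ Tuple.sort x) := by
  obtain ⟨hmono, hstable⟩ := Tuple.eq_sort_iff.1 (rfl : Tuple.sort x = Tuple.sort x)
  refine monotone_iff_forall_lt.2 fun i j hij => ?_
  have hle : x (Tuple.sort x i) ≤ x (Tuple.sort x j) := hmono hij.le
  have hlt (h : x (Tuple.sort x i) = x (Tuple.sort x j)) : Tuple.sort x i < Tuple.sort x j :=
    hstable i j hij h
  simp only [Function.comp_apply, raise]
  split_ifs <;> omega

theorem card_le_val (ht : t ≤ n) : #{j : Fin n | t ≤ j} + t = n := by
  have h := card_filter_add_card_filter_not (s := (univ : Finset (Fin n))) fun j => (j : ℕ) < t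
  simp only [not_lt, Fin.card_filter_val_lt, card_univ, Fintype.card_fin] at h
  omega

theorem sum_raise_add (x : Fin n → ℕ) (ht : t ≤ n) : ∑ j, raise x t j + t = ∑ j, x j + n := by
  simp only [raise, sum_add_distrib, ← card_filter, add_assoc, card_le_val ht]

theorem raise_comp_swap {i j : Fin n} (hij : (i : ℕ) + 1 = j) (ht : t ≠ j) :
    raise (x ∘ Equiv.swap i j) t = raise x t ∘ Equiv.swap i j := by
  funext l
  have : t ≤ l ↔ t ≤ (Equiv.swap i j l : ℕ) := by
    rw [Equiv.swap_apply_def]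
    split_ifs with hi hj
    · subst hi; omega
    · subst hj; omega
    · rfl
  simp only [raise, Function.comp_apply, this]

theorem card_filter_comp_equiv {α β : Type*} [Fintype α] [Fintype β] (e : α ≃ β) (p : β → Prop)
    [DecidablePred p] : #{i | p (e i)} = #{j | p j} :=
  card_equiv e fun i => by simp only [mem_filter, mem_univ, true_and]

theorem card_filter_raise_eq {σ : Equiv.Perm (Fin n)} (h : raise x s = raise y t ∘ σ)
    (p : ℕ → Prop) [DecidablePred p] : #{j | p (raise x s j)} = #{j | p (raise y t j)} := by
  rw [h]
  exact card_filter_comp_equiv σ fun j => p (raise y t j)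

theorem card_lt_raise (x : Fin n → ℕ) (t c : ℕ) :
    #{j | c < raise x t j} =
      #{j : Fin n | j < t ∧ c < x j} + #{j : Fin n | t ≤ j ∧ c ≤ x j} := by
  rw [← card_union_of_disjoint (disjoint_filter.2 fun j _ h h' => by omega), ← filter_or]
  refine congrArg card (filter_congr fun j _ => ?_)
  rcases lt_or_ge (j : ℕ) t with h | h
  · rw [raise_of_lt h]; omega
  · rw [raise_of_le h]; omega

theorem card_le_eq_add (x : Fin n → ℕ) (t c : ℕ) :
    #{j | c ≤ x j} = #{j : Fin n | j < t ∧ c ≤ x j} + #{j : Fin n | t ≤ j ∧ c ≤ x j} := by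
  rw [← card_union_of_disjoint (disjoint_filter.2 fun j _ h h' => by omega), ← filter_or]
  exact congrArg card (filter_congr fun j _ => by omega)

theorem card_le_eq_of_raise_eq {σ : Equiv.Perm (Fin n)} (h : raise x t = raise y t ∘ σ)
    (hxy : ∀ j : Fin n, j < t → x j = y j) (c : ℕ) : #{j | c ≤ x j} = #{j | c ≤ y j} := by
  have hprefix (d : ℕ) : #{j : Fin n | j < t ∧ d ≤ x j} = #{j : Fin n | j < t ∧ d ≤ y j} :=
    congrArg card (filter_congr fun j _ => and_congr_right fun hj => by rw [hxy j hj])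
  have hraise := card_filter_raise_eq h (c < ·)
  rw [card_lt_raise, card_lt_raise] at hraise
  rw [card_le_eq_add x t, card_le_eq_add y t, hprefix c]
  have := hprefix (c + 1)
  simp only [Nat.succ_le_iff] at this
  omega

theorem card_lt_and_le_eq_of_raise_eq {σ : Equiv.Perm (Fin n)} (h : raise x t = raise y t ∘ σ)
    (hxy : ∀ c, #{j | c ≤ x j} = #{j | c ≤ y j}) (c : ℕ) :
    #{j : Fin n | j < t ∧ c ≤ x j} = #{j : Fin n | j < t ∧ c ≤ y j} := by
  have hsuffix (c : ℕ) : #{j : Fin n | t ≤ j ∧ c ≤ x j} = #{j : Fin n | t ≤ j ∧ c ≤ y j} := by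
    induction c with
    | zero => simp only [zero_le, and_true]
    | succ c ih =>
      have hraise := card_filter_raise_eq h (c < ·)
      have hc := hxy (c + 1)
      rw [card_lt_raise, card_lt_raise] at hraise
      rw [card_le_eq_add x t, card_le_eq_add y t] at hc
      simp only [Nat.succ_le_iff] at hc ⊢
      omega
  have hc := hxy c
  rw [card_le_eq_add x t, card_le_eq_add y t, hsuffix c] at hc
  exact Nat.add_right_cancel hc

theorem le_of_card_lt_and_lt_eq {i : Fin n} (hit : i < t) (hpre : ∀ j < i, x j = y j)
    (hmax : ∀ j, i ≤ j → j < t → y j ≤ y i)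
    (hcard : #{j : Fin n | j < t ∧ y i < x j} = #{j : Fin n | j < t ∧ y i < y j}) :
    x i ≤ y i := by
  by_contra! hlt
  refine hcard.not_gt (card_lt_card ((ssubset_iff_of_subset fun j hj => ?_).2 ⟨i, ?_, ?_⟩))
  · obtain ⟨hjt, hj⟩ := (mem_filter.1 hj).2
    have hji : j < i := not_le.1 fun hij => (hmax j hij hjt).not_gt hj
    exact mem_filter.2 ⟨mem_univ j, hjt, hpre j hji ▸ hj⟩
  · exact mem_filter.2 ⟨mem_univ i, hit, hlt⟩
  · exact fun hi => lt_irrefl _ (mem_filter.1 hi).2.2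

end Words

variable {k q : ℕ}

section Vertices

variable {a b : Seq k q} {s t : ℕ}

/-- The sequence `a` as a word over `ℕ`. -/
def entries (a : Seq k q) : Fin (k - 1) → ℕ := fun j => a j

theorem sortPerm_eq_sort_entries (a : Seq k q) : sortPerm a = Tuple.sort (entries a) := by
  obtain ⟨hmono, hstable⟩ := Tuple.eq_sort_iff.1 (rfl : sortPerm a = Tuple.sort a)
  exact Tuple.eq_sort_iff.2 ⟨hmono, fun i j hij h => hstable i j hij (Fin.ext h)⟩

theorem vert_apply (v : Fin (k - 1) → ℤ) (π : Equiv.Perm (Fin (k - 1))) (i : ℕ)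
    (p : Fin (k - 1)) : vert v π i p = v p + if k ≤ (π.symm p : ℕ) + i then 1 else 0 := by
  have hsingle (j : Fin (k - 1)) : (Pi.single (π j) 1 : Fin (k - 1) → ℤ) p =
      if j = π.symm p then 1 else 0 := by
    rw [Pi.single_apply]
    exact if_congr (by rw [Equiv.eq_symm_apply, eq_comm]) rfl rfl
  simp only [vert, Pi.add_apply, Finset.sum_apply, hsingle, sum_ite_eq', mem_filter, mem_univ,
    true_and]

theorem seqVert_apply (a : Seq k q) (t : ℕ) (p : Fin (k - 1)) :
    seqVert a (k - t) p = raise (entries a) t (sortPerm a p) := by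
  have hiff : k ≤ (sortPerm a p : ℕ) + (k - t) ↔ t ≤ sortPerm a p := by omega
  simp only [seqVert, vert_apply, ← Equiv.Perm.inv_def, inv_inv, hiff, raise, entries,
    Nat.cast_add, Nat.cast_ite, Nat.cast_one, Nat.cast_zero]

theorem seqVert_eq_iff :
    seqVert a (k - s) = seqVert b (k - t) ↔
      ∃ σ : Equiv.Perm (Fin (k - 1)), raise (entries a) s = raise (entries b) t ∘ σ := by
  have hiff : seqVert a (k - s) = seqVert b (k - t) ↔
      raise (entries a) s ∘ sortPerm a = raise (entries b) t ∘ sortPerm b := by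
    simp only [funext_iff, seqVert_apply, Nat.cast_inj, Function.comp_apply]
  rw [hiff]
  constructor
  · refine fun h => ⟨(sortPerm a).symm.trans (sortPerm b), funext fun j => ?_⟩
    simpa using congrFun h ((sortPerm a).symm j)
  · rintro ⟨σ, h⟩
    have hsort (a : Seq k q) (t : ℕ) : raise (entries a) t ∘ sortPerm a =
        raise (entries a) t ∘ Tuple.sort (raise (entries a) t) := by
      rw [sortPerm_eq_sort_entries]
      exact Tuple.comp_sort_eq_comp_iff_monotone.2 (monotone_raise_comp_sort _ _)
    rw [hsort, hsort, h, Tuple.comp_perm_comp_sort_eq_comp_sort]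

theorem sumEntries_add_eq_of_seqVert_eq (hs : s < k) (ht : t < k)
    (h : seqVert a (k - s) = seqVert b (k - t)) : sumEntries a + t = sumEntries b + s := by
  obtain ⟨σ, hσ⟩ := seqVert_eq_iff.1 h
  have hsum : ∑ j, raise (entries a) s j = ∑ j, raise (entries b) t j := by
    rw [hσ]
    exact Equiv.sum_comp σ (raise (entries b) t)
  have ha : ∑ j, raise (entries a) s j + s = sumEntries a + (k - 1) :=
    sum_raise_add _ (Nat.le_sub_one_of_lt hs)
  have hb : ∑ j, raise (entries b) t j + t = sumEntries b + (k - 1) :=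
    sum_raise_add _ (Nat.le_sub_one_of_lt ht)
  omega

theorem mem_seqFacet {x : Fin (k - 1) → ℤ} :
    x ∈ seqFacet a ↔ ∃ t < k, x = seqVert a (k - t) := by
  simp only [seqFacet, mem_image, mem_Icc]
  constructor
  · rintro ⟨i, hi, rfl⟩
    exact ⟨k - i, by omega, by rw [Nat.sub_sub_self hi.2]⟩
  · rintro ⟨t, ht, rfl⟩
    exact ⟨k - t, by omega, rfl⟩

theorem seqVert_injOn (a : Seq k q) : Set.InjOn (fun t => seqVert a (k - t)) (Set.Iio k) :=
  fun _ hs _ ht h => (Nat.add_left_cancel (sumEntries_add_eq_of_seqVert_eq hs ht h)).symm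

theorem card_seqFacet (a : Seq k q) : #(seqFacet a) = k := by
  have himage : seqFacet a = (range k).image fun t => seqVert a (k - t) := by
    ext x
    simp only [mem_seqFacet, mem_image, mem_range, eq_comm]
  rw [himage, card_image_of_injOn (by rw [coe_range]; exact seqVert_injOn a), card_range]

end Vertices

section Cells

variable {v : Fin (k - 1) → ℤ} {π : Equiv.Perm (Fin (k - 1))}

theorem Consistent.lt_of_lt (h : Consistent v π) (hv : Monotone v) {i j : Fin (k - 1)}
    (hij : i < j) (hvij : v i = v j) : π.symm i < π.symm j := by
  have hmono : StrictMonoOn π.symm (v ⁻¹' {v j}) := by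
    refine strictMonoOn_of_lt_succ (Set.ordConnected_singleton.preimage_mono hv)
      fun p hp hpv hsv => h p _ ?_ (Eq.trans hpv (Eq.symm hsv))
    exact Nat.covBy_iff_add_one_eq.1 (Fin.covBy_iff.1 (Order.covBy_succ_of_not_isMax hp))
  exact hmono hvij rfl hij

theorem seqFacet_eq_cell (a : Seq k q) :
    seqFacet a = cell (fun j => ((a (sortPerm a j) : ℕ) : ℤ)) (sortPerm a)⁻¹ := rfl

theorem exists_cell_eq_seqFacet (hv : v ∈ W k q) (hv' : v + 1 ∈ W k q) (hπ : Consistent v π) :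
    ∃ a : Seq k q, cell v π = seqFacet a := by
  obtain ⟨hmono, hnonneg⟩ := hv
  have hlt (j : Fin (k - 1)) : (v j).toNat < q := by
    have h₀ := (hnonneg j).1
    have h₁ : v j + 1 ≤ q := (hv'.2 j).2
    omega
  let a : Seq k q := fun j => ⟨(v (π j)).toNat, hlt _⟩
  have ha (j : Fin (k - 1)) : ((a (π.symm j) : ℕ) : ℤ) = v j := by
    simpa only [a, Equiv.apply_symm_apply] using Int.toNat_of_nonneg (hnonneg j).1
  have hsort : π.symm = sortPerm a := by
    refine Tuple.eq_sort_iff.2 ⟨fun i j hij => ?_, fun i j hij h => hπ.lt_of_lt hmono hij ?_⟩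
    · exact Fin.le_def.2 (Nat.cast_le.1 (ha i ▸ ha j ▸ hmono hij))
    · rw [← ha i, ← ha j, h]
  refine ⟨a, ?_⟩
  rw [seqFacet_eq_cell, ← hsort]
  simp only [ha]
  rfl

theorem exists_seqFacet_eq_cell (a : Seq k q) : ∃ (v : Fin (k - 1) → ℤ)
    (π : Equiv.Perm (Fin (k - 1))),
    v ∈ W k q ∧ v + 1 ∈ W k q ∧ Consistent v π ∧ seqFacet a = cell v π := by
  obtain ⟨hsort, hstable⟩ := Tuple.eq_sort_iff.1 (rfl : sortPerm a = Tuple.sort a)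
  have hmono : Monotone fun j => ((a (sortPerm a j) : ℕ) : ℤ) :=
    fun _ _ hij => Int.ofNat_le.2 (hsort hij)
  refine ⟨_, (sortPerm a)⁻¹, ⟨hmono, fun i => ?_⟩, ⟨hmono.add_const 1, fun i => ?_⟩,
    fun i j hij h => ?_, rfl⟩
  · have := (a (sortPerm a i)).isLt
    omega
  · have := (a (sortPerm a i)).isLt
    simp only [Pi.add_apply, Pi.one_apply]
    omega
  · exact hstable i j (Fin.lt_def.2 (by omega)) (Fin.ext (Int.ofNat_inj.1 h))

theorem isGeneratedBy_seqFacet :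
    IsGeneratedBy (T k q) (seqFacet : Seq k q → Finset (Fin (k - 1) → ℤ)) := by
  refine fun s => and_congr_right fun _ => ⟨?_, ?_⟩
  · rintro ⟨v, π, hv, hv', hπ, hs⟩
    obtain ⟨a, ha⟩ := exists_cell_eq_seqFacet hv hv' hπ
    exact ⟨a, ha ▸ hs⟩
  · rintro ⟨a, hs⟩
    obtain ⟨v, π, hv, hv', hπ, ha⟩ := exists_seqFacet_eq_cell a
    exact ⟨v, π, hv, hv', hπ, ha ▸ hs⟩

end Cells

section Order

variable {a b : Seq k q}

/-- The triple `(m(a), S(a), a)`: `Precedes` is the lexicographic order of these triples, the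
order of the last component being reversed. -/
def precedesKey (a : Seq k q) : ℕ ×ₗ ℕ ×ₗ (Lex (Seq k q))ᵒᵈ :=
  toLex (maxEntry a, toLex (sumEntries a, OrderDual.toDual (toLex a)))

theorem precedesKey_injective :
    Function.Injective (precedesKey : Seq k q → ℕ ×ₗ ℕ ×ₗ (Lex (Seq k q))ᵒᵈ) := fun _ _ h =>
  congrArg (fun x : ℕ ×ₗ ℕ ×ₗ (Lex (Seq k q))ᵒᵈ =>
    (ofLex (OrderDual.ofDual (ofLex (ofLex x).2).2) : Seq k q)) h

theorem precedes_iff_precedesKey_lt : Precedes a b ↔ precedesKey a < precedesKey b := by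
  have hlex : (∃ i, b i < a i ∧ ∀ j, j < i → a j = b j) ↔ toLex b < toLex a :=
    exists_congr fun i => and_comm.trans
      (and_congr_left' (forall₂_congr fun _ _ => eq_comm))
  simp only [Precedes, precedesKey, Prod.Lex.toLex_lt_toLex, hlex, OrderDual.toDual_lt_toDual]
  tauto

instance : IsStrictTotalOrder (Seq k q) Precedes :=
  RelEmbedding.isStrictTotalOrder
    (⟨⟨precedesKey, precedesKey_injective⟩, precedes_iff_precedesKey_lt.symm⟩ :
      (Precedes : Seq k q → Seq k q → Prop) ↪r (· < ·))

theorem precedes_of_maxEntry_le_of_sumEntries_lt (hm : maxEntry a ≤ maxEntry b)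
    (hS : sumEntries a < sumEntries b) : Precedes a b :=
  hm.lt_or_eq.imp_right fun h => Or.inl ⟨h, hS⟩

end Order

section Ascents

variable {a b : Seq k q} {i j l : Fin (k - 1)}

theorem mem_ascents_of_val_eq_zero (hj : (j : ℕ) = 0) : j ∈ ascents a ↔ 0 < (a j : ℕ) := by
  have hcast : j.castSucc = 0 := Fin.ext hj
  simp only [ascents, zeroCons, mem_filter, mem_univ, true_and, hcast, Fin.cons_zero,
    Fin.cons_succ]

theorem mem_ascents_of_val_add_one_eq (hij : (i : ℕ) + 1 = j) : j ∈ ascents a ↔ a i < a j := by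
  have hcast : j.castSucc = i.succ := Fin.ext hij.symm
  simp only [ascents, zeroCons, mem_filter, mem_univ, true_and, hcast, Fin.cons_succ,
    Fin.val_fin_lt]

theorem le_of_forall_notMem_ascents (hil : i ≤ l) (h : ∀ p, i < p → p ≤ l → p ∉ ascents a) :
    a l ≤ a i := by
  have hanti : AntitoneOn a (Set.Icc i l) := by
    refine antitoneOn_of_succ_le Set.ordConnected_Icc fun p hp hpi hpl => not_lt.1 fun hlt => ?_
    have hcovBy := Order.covBy_succ_of_not_isMax hp
    exact h _ (hpi.1.trans_lt hcovBy.lt) hpl.2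
      ((mem_ascents_of_val_add_one_eq (Nat.covBy_iff_add_one_eq.1 (Fin.covBy_iff.1 hcovBy))).2 hlt)
  exact hanti (Set.left_mem_Icc.2 hil) (Set.right_mem_Icc.2 hil) hil

theorem eq_zero_of_forall_notMem_ascents (h : ∀ p ≤ l, p ∉ ascents a) : (a l : ℕ) = 0 := by
  let z : Fin (k - 1) := ⟨0, l.pos⟩
  have hzl : z ≤ l := Fin.le_def.2 (Nat.zero_le _)
  have hz : ¬ 0 < (a z : ℕ) := fun hpos => h z hzl ((mem_ascents_of_val_eq_zero rfl).2 hpos)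
  have hle : (a l : ℕ) ≤ a z := le_of_forall_notMem_ascents hzl fun p _ => h p
  omega

theorem exists_mem_ascents_le_of_pos (hi : 0 < (a i : ℕ)) :
    ∃ p ∈ ascents a, p ≤ i ∧ a i ≤ a p := by
  have hne : {p ∈ ascents a | p ≤ i}.Nonempty := by
    by_contra! hempty
    exact hi.ne' (eq_zero_of_forall_notMem_ascents fun p hpi hp =>
      filter_eq_empty_iff.1 hempty hp hpi)
  obtain ⟨p, hp⟩ := exists_maximal hne
  obtain ⟨hpa, hpi⟩ := mem_filter.1 hp.prop
  exact ⟨p, hpa, hpi, le_of_forall_notMem_ascents hpi fun l hpl hli hl =>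
    hp.not_prop_of_gt hpl (mem_filter.2 ⟨hl, hli⟩)⟩

theorem exists_gt_forall_le (a : Seq k q) (i : Fin (k - 1)) :
    ∃ t : ℕ, i < t ∧ (∀ l, i ≤ l → l < t → a l ≤ a i) ∧
      (t = k - 1 ∨ ∃ p ∈ ascents a, (p : ℕ) = t) := by
  by_cases hne : {p ∈ ascents a | i < p}.Nonempty
  · obtain ⟨p, hp⟩ := exists_minimal hne
    obtain ⟨hpa, hip⟩ := mem_filter.1 hp.prop
    refine ⟨p, hip, fun l hil hlp => ?_, Or.inr ⟨p, hpa, rfl⟩⟩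
    exact le_of_forall_notMem_ascents hil fun m him hml hm =>
      hp.not_prop_of_lt (hml.trans_lt hlp) (mem_filter.2 ⟨hm, him⟩)
  · refine ⟨k - 1, i.isLt, fun l hil _ => ?_, Or.inl rfl⟩
    exact le_of_forall_notMem_ascents hil fun m him _ hm => hne ⟨m, mem_filter.2 ⟨hm, him⟩⟩

/-- The vertices of `F(a)` indexed by the ascents of `a`, which turn out to form the restriction of
`F(a)`. The ascent `i` of the paper is `j + 1`, whence the index `k + 1 - i = k - j`. -/
def ascentVertices (a : Seq k q) : Finset (Fin (k - 1) → ℤ) :=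
  (ascents a).image fun j : Fin (k - 1) => seqVert a (k - j)

theorem card_ascentVertices (a : Seq k q) : #(ascentVertices a) = #(ascents a) :=
  card_image_of_injOn fun i _ j _ hij =>
    Fin.ext (seqVert_injOn a (show (i : ℕ) < k by omega) (show (j : ℕ) < k by omega) hij)

theorem ascentVertices_subset_seqFacet (a : Seq k q) : ascentVertices a ⊆ seqFacet a :=
  image_subset_iff.2 fun j _ => mem_seqFacet.2 ⟨j, by omega, rfl⟩

end Ascents

section EarlierFacets

variable {b : Seq k q} {i j : Fin (k - 1)}

theorem val_finRotate {n : ℕ} (x : Fin n) :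
    (finRotate n x : ℕ) = if (x : ℕ) + 1 = n then 0 else (x : ℕ) + 1 := by
  cases n with
  | zero => exact x.elim0
  | succ n =>
    rw [coe_finRotate]
    exact if_congr (by rw [Fin.ext_iff, Fin.val_last, Nat.succ_inj]) rfl rfl

/-- The sequence obtained from `b` by moving its first entry to the end and lowering it by one.
The truncated subtraction is harmless where it is used: there the first entry is positive. -/
def rotateLower (b : Seq k q) : Seq k q := fun x =>
  ⟨raise (entries b) 1 (finRotate (k - 1) x) - 1,
    (Nat.sub_le_of_le_add (raise_le _ _ _)).trans_lt (b _).isLt⟩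

theorem entries_rotateLower_le (b : Seq k q) (x : Fin (k - 1)) :
    entries (rotateLower b) x ≤ entries b (finRotate (k - 1) x) :=
  Nat.sub_le_of_le_add (raise_le _ _ _)

theorem raise_rotateLower (hj : (j : ℕ) = 0) (hpos : 0 < (b j : ℕ)) {t : ℕ} (ht : t < k - 1) :
    raise (entries b) (t + 1) ∘ finRotate (k - 1) = raise (entries (rotateLower b)) t := by
  funext x
  have hx := val_finRotate x
  simp only [Function.comp_apply, raise, entries, rotateLower]
  split_ifs at hx with hlast
  · have hxj : finRotate (k - 1) x = j := Fin.ext (hx.trans hj.symm)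
    rw [hxj]
    split_ifs <;> omega
  · split_ifs <;> omega

theorem maxEntry_rotateLower_le (b : Seq k q) : maxEntry (rotateLower b) ≤ maxEntry b :=
  Finset.sup_le fun x _ => (entries_rotateLower_le b x).trans
    (le_sup (f := entries b) (mem_univ (finRotate (k - 1) x)))

theorem seqVert_rotateLower (hj : (j : ℕ) = 0) (hpos : 0 < (b j : ℕ)) {t : ℕ} (ht : t < k - 1) :
    seqVert b (k - (t + 1)) = seqVert (rotateLower b) (k - t) :=
  (seqVert_eq_iff.2 ⟨finRotate (k - 1), (raise_rotateLower hj hpos ht).symm⟩).symm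

theorem exists_precedes_of_val_eq_zero (hj : (j : ℕ) = 0) (hpos : 0 < (b j : ℕ)) :
    ∃ c : Seq k q, Precedes c b ∧ ∀ t < k, t ≠ j → seqVert b (k - t) ∈ seqFacet c := by
  have hsum := sumEntries_add_eq_of_seqVert_eq (by omega) (by omega)
    (seqVert_rotateLower hj hpos (t := 0) (by omega))
  refine ⟨rotateLower b, precedes_of_maxEntry_le_of_sumEntries_lt (maxEntry_rotateLower_le b)
    (by omega), fun t ht htj => mem_seqFacet.2 ⟨t - 1, by omega, ?_⟩⟩
  obtain ⟨s, rfl⟩ := Nat.exists_eq_succ_of_ne_zero (hj ▸ htj)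
  exact seqVert_rotateLower hj hpos (by omega)

theorem maxEntry_comp_perm (b : Seq k q) (σ : Equiv.Perm (Fin (k - 1))) :
    maxEntry (b ∘ σ) = maxEntry b := by
  have hmap := sup_map univ σ.toEmbedding fun l => (b l : ℕ)
  rw [map_univ_equiv] at hmap
  exact hmap.symm

theorem sumEntries_comp_perm (b : Seq k q) (σ : Equiv.Perm (Fin (k - 1))) :
    sumEntries (b ∘ σ) = sumEntries b :=
  Equiv.sum_comp σ fun l => (b l : ℕ)

theorem exists_precedes_of_val_add_one_eq (hij : (i : ℕ) + 1 = j) (hlt : b i < b j) :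
    ∃ c : Seq k q, Precedes c b ∧ ∀ t < k, t ≠ j → seqVert b (k - t) ∈ seqFacet c := by
  refine ⟨b ∘ Equiv.swap i j, Or.inr (Or.inr ⟨maxEntry_comp_perm b _, sumEntries_comp_perm b _, i,
    ?_, fun l hl => ?_⟩), fun t ht htj => mem_seqFacet.2 ⟨t, ht, ?_⟩⟩
  · rwa [Function.comp_apply, Equiv.swap_apply_left]
  · rw [Function.comp_apply, Equiv.swap_apply_of_ne_of_ne hl.ne (by omega)]
  · exact ((seqVert_eq_iff (a := b ∘ Equiv.swap i j) (b := b)).2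
      ⟨Equiv.swap i j, raise_comp_swap (x := entries b) hij htj⟩).symm

theorem exists_precedes_of_mem_ascents (hj : j ∈ ascents b) :
    ∃ c : Seq k q, Precedes c b ∧ seqFacet b \ {seqVert b (k - j)} ⊆ seqFacet c := by
  obtain ⟨c, hcb, hc⟩ :
      ∃ c : Seq k q, Precedes c b ∧ ∀ t < k, t ≠ j → seqVert b (k - t) ∈ seqFacet c := by
    by_cases hj0 : (j : ℕ) = 0
    · exact exists_precedes_of_val_eq_zero hj0 ((mem_ascents_of_val_eq_zero hj0).1 hj)
    · have hij : ((⟨j - 1, by omega⟩ : Fin (k - 1)) : ℕ) + 1 = j := Nat.succ_pred hj0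
      exact exists_precedes_of_val_add_one_eq hij ((mem_ascents_of_val_add_one_eq hij).1 hj)
  refine ⟨c, hcb, fun x hx => ?_⟩
  obtain ⟨hxb, hxj⟩ := mem_sdiff.1 hx
  obtain ⟨t, ht, rfl⟩ := mem_seqFacet.1 hxb
  exact hc t ht fun htj => hxj (mem_singleton.2 (by rw [htj]))

end EarlierFacets

section AscentVertices

variable {a b : Seq k q} {i j : Fin (k - 1)}

theorem exists_raise_eq_of_ascentVertices_subset (h : ascentVertices b ⊆ seqFacet a)
    (hj : j ∈ ascents b) : ∃ t < k, sumEntries b + t = sumEntries a + j ∧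
      ∃ σ : Equiv.Perm (Fin (k - 1)), raise (entries b) j = raise (entries a) t ∘ σ := by
  obtain ⟨t, ht, hjt⟩ := mem_seqFacet.1 (h (mem_image_of_mem _ hj))
  exact ⟨t, ht, sumEntries_add_eq_of_seqVert_eq (by omega) ht hjt, seqVert_eq_iff.1 hjt⟩

theorem exists_raise_eq_of_sumEntries_eq (h : ascentVertices b ⊆ seqFacet a)
    (hS : sumEntries a = sumEntries b) (hj : j ∈ ascents b) :
    ∃ σ : Equiv.Perm (Fin (k - 1)), raise (entries b) j = raise (entries a) j ∘ σ := by
  obtain ⟨t, -, hsum, hσ⟩ := exists_raise_eq_of_ascentVertices_subset h hj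
  obtain rfl : t = j := by omega
  exact hσ

theorem maxEntry_le_of_ascentVertices_subset (h : ascentVertices b ⊆ seqFacet a) :
    maxEntry b ≤ maxEntry a := by
  refine Finset.sup_le fun i _ => ?_
  rcases Nat.eq_zero_or_pos (b i : ℕ) with hzero | hpos
  · rw [hzero]
    exact Nat.zero_le _
  obtain ⟨p, hp, -, hip⟩ := exists_mem_ascents_le_of_pos hpos
  obtain ⟨t, -, -, σ, hσ⟩ := exists_raise_eq_of_ascentVertices_subset h hp
  have hsucc : entries b p + 1 ≤ entries a (σ p) + 1 := calc
    entries b p + 1 = raise (entries b) p p := (raise_of_le le_rfl).symm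
    _ = raise (entries a) t (σ p) := congrFun hσ p
    _ ≤ entries a (σ p) + 1 := raise_le _ _ _
  exact (Fin.le_def.1 hip).trans ((Nat.succ_le_succ_iff.1 hsucc).trans
    (le_sup (f := entries a) (mem_univ (σ p))))

theorem sumEntries_le_of_ascentVertices_subset (h : ascentVertices b ⊆ seqFacet a) :
    sumEntries b ≤ sumEntries a := by
  rcases (ascents b).eq_empty_or_nonempty with hempty | hne
  · have hzero : sumEntries b = 0 := sum_eq_zero fun l _ =>
      eq_zero_of_forall_notMem_ascents fun p _ => by simp only [hempty, notMem_empty, not_false_iff]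
    exact hzero ▸ Nat.zero_le _
  · obtain ⟨j, hj⟩ := exists_minimal hne
    obtain ⟨t, ht, hsum, σ, hσ⟩ := exists_raise_eq_of_ascentVertices_subset h hj.prop
    have hprefix : #{l : Fin (k - 1) | l < (j : ℕ) ∧ 0 < entries b l} = 0 := by
      refine card_eq_zero.2 (filter_eq_empty_iff.2 fun l _ hl => hl.2.ne' ?_)
      exact eq_zero_of_forall_notMem_ascents fun p hpl =>
        hj.not_prop_of_lt (hpl.trans_lt hl.1)
    have hcount := card_filter_raise_eq hσ (0 < ·)
    have hjk := card_le_val (n := k - 1) j.isLt.le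
    have htk := card_le_val (n := k - 1) (Nat.le_sub_one_of_lt ht)
    simp only [card_lt_raise, hprefix, zero_le, and_true] at hcount
    omega

theorem card_lt_and_lt_eq_of_mem_ascents (h : ascentVertices b ⊆ seqFacet a)
    (hS : sumEntries a = sumEntries b) (hpre : ∀ l < i, a l = b l) {p : Fin (k - 1)}
    (hp : p ∈ ascents b) (hpi : p ≤ i) {t : ℕ} (ht : t = k - 1 ∨ ∃ p ∈ ascents b, (p : ℕ) = t)
    (c : ℕ) : #{l : Fin (k - 1) | l < t ∧ c ≤ entries b l} =
      #{l : Fin (k - 1) | l < t ∧ c ≤ entries a l} := by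
  obtain ⟨σ, hσ⟩ := exists_raise_eq_of_sumEntries_eq h hS hp
  have htotal := card_le_eq_of_raise_eq hσ fun l (hl : l < p) =>
    congrArg Fin.val (hpre l (hl.trans_le hpi)).symm
  rcases ht with rfl | ⟨p', hp', rfl⟩
  · simpa only [Fin.is_lt, true_and] using htotal c
  · obtain ⟨σ', hσ'⟩ := exists_raise_eq_of_sumEntries_eq h hS hp'
    exact card_lt_and_le_eq_of_raise_eq hσ' htotal c

theorem le_of_ascentVertices_subset (h : ascentVertices b ⊆ seqFacet a)
    (hS : sumEntries a = sumEntries b) (hpre : ∀ l < i, a l = b l) : a i ≤ b i := by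
  obtain ⟨t, hit, hmax, ht⟩ := exists_gt_forall_le b i
  suffices hcard : #{l : Fin (k - 1) | l < t ∧ entries b i < entries a l} =
      #{l : Fin (k - 1) | l < t ∧ entries b i < entries b l} from
    le_of_card_lt_and_lt_eq hit (fun l hl => congrArg Fin.val (hpre l hl)) hmax hcard
  by_cases hfirst : ∃ p ∈ ascents b, p ≤ i
  · obtain ⟨p, hp, hpi⟩ := hfirst
    exact (card_lt_and_lt_eq_of_mem_ascents h hS hpre hp hpi ht (entries b i + 1)).symm
  push Not at hfirst
  have hzero : ∀ l ≤ i, entries b l = 0 := fun l hl =>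
    eq_zero_of_forall_notMem_ascents fun p hpl hp => (hfirst p hp).not_ge (hpl.trans hl)
  rw [hzero i le_rfl]
  rcases ht with rfl | ⟨p, hp, rfl⟩
  · have hb : ∀ l, entries b l = 0 := fun l => (le_total l i).elim (hzero l) fun hil =>
      Nat.le_zero.1 (hzero i le_rfl ▸ hmax l hil l.isLt)
    have ha : ∀ l, entries a l = 0 := fun l =>
      sum_eq_zero_iff.1 (hS.trans (sum_eq_zero fun l _ => hb l)) l (mem_univ l)
    simp only [ha, hb]
  · obtain ⟨σ, hσ⟩ := exists_raise_eq_of_sumEntries_eq h hS hp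
    have hcount := card_filter_raise_eq hσ (0 < ·)
    simp only [card_lt_raise, zero_le, and_true] at hcount
    exact (Nat.add_right_cancel hcount).symm

theorem not_precedes_of_ascentVertices_subset (h : ascentVertices b ⊆ seqFacet a) :
    ¬ Precedes a b := by
  rintro (hm | ⟨-, hS⟩ | ⟨-, hS, i, hi, hpre⟩)
  · exact (maxEntry_le_of_ascentVertices_subset h).not_gt hm
  · exact (sumEntries_le_of_ascentVertices_subset h).not_gt hS
  · exact (le_of_ascentVertices_subset h hS hpre).not_gt hi

theorem isRestrictionMap_ascentVertices :
    IsRestrictionMap (seqFacet : Seq k q → Finset (Fin (k - 1) → ℤ)) Precedes ascentVertices where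
  subset := ascentVertices_subset_seqFacet
  not_subset_of_rel _ _ hab h := not_precedes_of_ascentVertices_subset h hab
  exists_sdiff_subset _ _ hv := by
    obtain ⟨j, hj, rfl⟩ := mem_image.1 hv
    exact exists_precedes_of_mem_ascents hj

theorem isShellingOrder_seqFacet (hk : 1 ≤ k) :
    IsShellingOrder (T k q) (seqFacet : Seq k q → Finset (Fin (k - 1) → ℤ)) Precedes :=
  isRestrictionMap_ascentVertices.isShellingOrder isGeneratedBy_seqFacet card_seqFacet hk

theorem restriction_seqFacet (a : Seq k q) : restriction seqFacet Precedes a =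
    {x | ∃ j ∈ ascents a, x = seqVert a (k - (j : ℕ))} := by
  ext x
  simp only [isRestrictionMap_ascentVertices.restriction_eq, ascentVertices, mem_coe, mem_image,
    Set.mem_ofPred_eq, eq_comm]

theorem hVector_T (hk : 1 ≤ k) (hq : 1 ≤ q) {i : ℕ} (hi : i ≤ k) :
    hVector (T k q) i = #{a : Seq k q | #(ascents a) = i} := by
  have hnonempty : Nonempty (Seq k q) := ⟨fun _ => ⟨0, hq⟩⟩
  have hshell := isShellingOrder_seqFacet (q := q) hk
  have hdim : dimSucc (T k q) = k :=
    (hshell.dimSucc_eq isGeneratedBy_seqFacet hnonempty.some).trans (card_seqFacet _)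
  rw [hshell.hVector_eq_card isGeneratedBy_seqFacet
    isRestrictionMap_ascentVertices.restriction_eq (hi.trans_eq hdim.symm)]
  simp only [card_ascentVertices]

end AscentVertices

end Edgewise

/-- For `k, q ≥ 1`: the order `Precedes` is a shelling order of the facets `F(a)` of `T_{k,q}`;
the restriction of `F(a)` is `{v_a^{(k+1-i)} : 1 ≤ i ≤ k-1, a_{i-1} < a_i}` with `a_0 = 0`
(here `i = j + 1`, so `k + 1 - i = k - j`); and `h_i(T_{k,q})`, `0 ≤ i ≤ k`, is the number of
sequences `(0, a_1, …, a_{k-1})` with exactly `i` ascents. -/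
theorem mainTheorem3 (k q : ℕ) (hk : 1 ≤ k) (hq : 1 ≤ q) :
    Edgewise.IsShellingOrder (Edgewise.T k q)
      (Edgewise.seqFacet : Edgewise.Seq k q → Finset (Fin (k - 1) → ℤ)) Edgewise.Precedes ∧
    (∀ a : Edgewise.Seq k q,
      Edgewise.restriction Edgewise.seqFacet Edgewise.Precedes a =
        {x | ∃ j ∈ Edgewise.ascents a, x = Edgewise.seqVert a (k - (j : ℕ))}) ∧
    (∀ i : ℕ, i ≤ k →
      Edgewise.hVector (Edgewise.T k q) i =
        (((Finset.univ : Finset (Edgewise.Seq k q)).filter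
          fun a => (Edgewise.ascents a).card = i).card : ℤ)) :=
  ⟨Edgewise.isShellingOrder_seqFacet hk, Edgewise.restriction_seqFacet,
    fun _ hi => Edgewise.hVector_T hk hq hi⟩
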